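/- **Theorem (Kleene–Schützenberger, general alphabet).** Let $X$ be an arbitrary set (finite or infinite), $X^*$ the free monoid on $X$, $k$ a semiring (with $0$ and $1$, not necessarily commutative) and $f\in k^{X^*}$, i.e. $f:X^*\to k$. For $w\in X^*$ let $f_w:x\mapsto f(wx)$ be the right shift and ${}_wf:x\mapsto f(xw)$ the left shift of $f$ by $w$. Let $k\langle\langle X\rangle\rangle$ be the set $k^{X^*}$ with pointwise addition, the convolution product $(gh)(w)=\sum_{uv=w}g(u)h(v)$, and left and right scaling by $k$. For $g\in k\langle\langle X\rangle\rangle$ without constant term ($g(1_{X^*})=0$) let $g^*=\sum_{n\ge 0}g^n$ (for each word, only finitely many terms have a nonzero coefficient). The rational closure of a set $A\subseteq k\langle\langle X\rangle\rangle$ is the smallest subalgebra of $k\langle\langle X\rangle\rangle$ (subsemiring with unit, stable under left and right scaling) that contains $A$ and contains $g^*$ for each of its elements $g$ without constant term. The following are equivalent: i) there is a finitely generated left $k$-submodule of $k^{X^*}$, invariant under all right shifts, that contains $f_w$ for all $w\in X^*$; ii) there is a finitely generated right $k$-submodule of $k^{X^*}$, invariant under all left shifts, that contains ${}_wf$ for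 all $w\in X^*$; iii) there exist $n\in\mathbb N$, a row $\lambda\in k^{1\times n}$, a column $\gamma\in k^{n\times 1}$ and a morphism of monoids $\mu:X^*\to (k^{n\times n},\times)$ such that $f(w)=\lambda\mu(w)\gamma$ for all $w\in X^*$; iv) $f$ lies in the rational closure of $\overline{kX}=\{\sum_{x\in X}\alpha(x)\,x \;:\; \alpha\in k^X\}$. If $X$ is finite, then (i)–(iii) are also equivalent to: $f$ lies in the rational closure of $X$ itself. -/

import Mathlib

noncomputable section

namespace KleeneSchutzenberger

universe u v

/-! ### Shifts of functions on a monoid -/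

section Shifts

variable {M : Type u} {k : Type v} [Monoid M]

/-- The right shift `f_a : x ↦ f (a x)`. -/
def rightShift (a : M) (f : M → k) : M → k := fun x => f (a * x)

/-- The left shift `_a f : x ↦ f (x a)`. -/
def leftShift (a : M) (f : M → k) : M → k := fun x => f (x * a)

variable [Semiring k]

/-- Some finitely generated left submodule of `k^M`, invariant under the right shifts,
contains all the right shifts of `f`. -/
def RightShiftsFG (f : M → k) : Prop :=
  ∃ W : Submodule k (M → k), W.FG ∧ (∀ a : M, ∀ g ∈ W, rightShift a g ∈ W) ∧
    ∀ w : M, rightShift w f ∈ W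

/-- Some finitely generated right submodule of `k^M` (that is, a submodule for the action
`(f • c) x = f x * c` of the opposite semiring), invariant under the left shifts,
contains all the left shifts of `f`. -/
def LeftShiftsFG (f : M → k) : Prop :=
  ∃ W : Submodule kᵐᵒᵖ (M → k), W.FG ∧ (∀ a : M, ∀ g ∈ W, leftShift a g ∈ W) ∧
    ∀ w : M, leftShift w f ∈ W

/-- `f` has a linear representation `f w = λ μ(w) γ` with `λ` a row, `γ` a column and
`μ` a morphism of monoids into square matrices. -/
def HasLinearRepresentation (f : M → k) : Prop :=
  ∃ (n : ℕ) (lam : Matrix (Fin 1) (Fin n) k) (mu : M →* Matrix (Fin n) (Fin n) k)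
    (gam : Matrix (Fin n) (Fin 1) k), ∀ w : M, f w = (lam * mu w * gam) 0 0

end Shifts

/-! ### The algebra of noncommutative formal power series -/

/-- The finite set of factorizations `w = u v` of a word. -/
instance instMulAntidiagonalFreeMonoid (X : Type u) :
    Finset.HasMulAntidiagonal (FreeMonoid X) where
  mulAntidiagonal w := by
    classical
    exact (Finset.range (w.toList.length + 1)).image fun i =>
      (FreeMonoid.ofList (w.toList.take i), FreeMonoid.ofList (w.toList.drop i))
  mem_mulAntidiagonal := by
    classical
    rintro w ⟨a, b⟩
    simp only [Finset.mem_image, Finset.mem_range, Prod.mk.injEq]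
    constructor
    · rintro ⟨i, -, rfl, rfl⟩
      exact List.take_append_drop i w.toList
    · rintro rfl
      refine ⟨a.toList.length, ?_, ?_, ?_⟩
      · simp only [FreeMonoid.toList_mul, List.length_append]
        omega
      · simp
      · simp

/-- `k⟨⟨X⟩⟩`: the functions `X^* → k`, with the convolution product. -/
def Series (k : Type v) (X : Type u) : Type (max u v) := FreeMonoid X → k

namespace Series

variable {k : Type v} {X : Type u}

/-- A function on words, seen as a series. -/
def ofFun (f : FreeMonoid X → k) : Series k X := f

/-- The coefficient of a word in a series. -/
def coeff (w : FreeMonoid X) (f : Series k X) : k := f w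

@[simp] theorem coeff_ofFun (w : FreeMonoid X) (f : FreeMonoid X → k) :
    coeff w (ofFun f) = f w := rfl

@[ext] theorem ext {f g : Series k X} (h : ∀ w, coeff w f = coeff w g) : f = g := funext h

variable [Semiring k]

instance instAddCommMonoid : AddCommMonoid (Series k X) :=
  inferInstanceAs (AddCommMonoid (FreeMonoid X → k))

/-- Left scaling, `(c • f) w = c * f w`. -/
instance instModule : Module k (Series k X) :=
  inferInstanceAs (Module k (FreeMonoid X → k))

/-- Right scaling, `(f • c) w = f w * c`, as an action of the opposite semiring. -/
instance instModuleOp : Module kᵐᵒᵖ (Series k X) :=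
  inferInstanceAs (Module kᵐᵒᵖ (FreeMonoid X → k))

/-- The word `w` as a series. -/
def word (w : FreeMonoid X) : Series k X := ofFun (Set.indicator {w} fun _ => 1)

/-- The letter `x` as a series. -/
def letter (x : X) : Series k X := word (FreeMonoid.of x)

instance instOne : One (Series k X) := ⟨word 1⟩

instance instMul : Mul (Series k X) :=
  ⟨fun f g => ofFun fun w =>
    ∑ p ∈ Finset.HasMulAntidiagonal.mulAntidiagonal w, coeff p.1 f * coeff p.2 g⟩

@[simp] theorem coeff_zero (w : FreeMonoid X) : coeff w (0 : Series k X) = 0 := rfl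

@[simp] theorem coeff_add (w : FreeMonoid X) (f g : Series k X) :
    coeff w (f + g) = coeff w f + coeff w g := rfl

@[simp] theorem coeff_smul (w : FreeMonoid X) (c : k) (f : Series k X) :
    coeff w (c • f) = c * coeff w f := rfl

@[simp] theorem coeff_op_smul (w : FreeMonoid X) (c : k) (f : Series k X) :
    coeff w (MulOpposite.op c • f) = coeff w f * c := rfl

theorem coeff_word_self (w : FreeMonoid X) : coeff w (word w : Series k X) = 1 :=
  Set.indicator_of_mem (Set.mem_singleton w) fun _ => (1 : k)

theorem coeff_word_of_ne {v w : FreeMonoid X} (h : w ≠ v) :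
    coeff w (word v : Series k X) = 0 :=
  Set.indicator_of_notMem (s := {v}) (fun hw => h hw) fun _ => (1 : k)

theorem coeff_one_self : coeff 1 (1 : Series k X) = 1 :=
  coeff_word_self 1

theorem coeff_one_of_ne {w : FreeMonoid X} (h : w ≠ 1) : coeff w (1 : Series k X) = 0 :=
  coeff_word_of_ne h

theorem coeff_mul (w : FreeMonoid X) (f g : Series k X) :
    coeff w (f * g) =
      ∑ p ∈ Finset.HasMulAntidiagonal.mulAntidiagonal w, coeff p.1 f * coeff p.2 g := rfl

protected theorem one_mul (f : Series k X) : 1 * f = f := by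
  ext w
  rw [coeff_mul, Finset.sum_eq_single (1, w)]
  · simp [coeff_one_self]
  · rintro ⟨a, b⟩ hp hne
    rw [Finset.HasMulAntidiagonal.mem_mulAntidiagonal] at hp
    have ha : a ≠ 1 := by
      rintro rfl
      exact hne (by simpa using hp)
    simp [coeff_one_of_ne ha]
  · intro h
    exact absurd (by simp) h

protected theorem mul_one (f : Series k X) : f * 1 = f := by
  ext w
  rw [coeff_mul, Finset.sum_eq_single (w, 1)]
  · simp [coeff_one_self]
  · rintro ⟨a, b⟩ hp hne
    rw [Finset.HasMulAntidiagonal.mem_mulAntidiagonal] at hp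
    have hb : b ≠ 1 := by
      rintro rfl
      exact hne (by simpa using hp)
    simp [coeff_one_of_ne hb]
  · intro h
    exact absurd (by simp) h

protected theorem mul_assoc (f g h : Series k X) : f * g * h = f * (g * h) := by
  ext w
  simp only [coeff_mul, Finset.sum_mul, Finset.mul_sum, Finset.sum_sigma']
  refine Finset.sum_bij' (fun p _ => ⟨(p.2.1, p.2.2 * p.1.2), (p.2.2, p.1.2)⟩)
    (fun p _ => ⟨(p.1.1 * p.2.1, p.2.2), (p.1.1, p.2.1)⟩) ?_ ?_ ?_ ?_ ?_ <;>
    rintro ⟨⟨a, b⟩, ⟨c, d⟩⟩ hp <;>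
    simp only [Finset.mem_sigma, Finset.HasMulAntidiagonal.mem_mulAntidiagonal] at hp ⊢ <;>
    obtain ⟨rfl, rfl⟩ := hp <;>
    simp [mul_assoc]

instance instSemiring : Semiring (Series k X) where
  __ := instAddCommMonoid
  mul := (· * ·)
  one := 1
  left_distrib f g h := by
    ext w
    simp [coeff_mul, mul_add, Finset.sum_add_distrib]
  right_distrib f g h := by
    ext w
    simp [coeff_mul, add_mul, Finset.sum_add_distrib]
  zero_mul f := by
    ext w
    simp [coeff_mul]
  mul_zero f := by
    ext w
    simp [coeff_mul]
  mul_assoc := Series.mul_assoc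
  one_mul := Series.one_mul
  mul_one := Series.mul_one

/-- A family of series is summable if, for each word, it has only finitely many members
with a nonzero coefficient there. -/
def FamilySummable {ι : Type*} (F : ι → Series k X) : Prop :=
  ∀ w, (Function.support fun i => coeff w (F i)).Finite

/-- The sum of a summable family. -/
def familySum {ι : Type*} (F : ι → Series k X) : Series k X :=
  ofFun fun w => ∑ᶠ i, coeff w (F i)

/-- The star `f^* = ∑ f^n`; used for series without constant term only, where the family of
powers is summable. -/
def kstar (f : Series k X) : Series k X := familySum fun n : ℕ => f ^ n

theorem coeff_pow_eq_zero {f : Series k X} (hf : coeff 1 f = 0) :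
    ∀ (n : ℕ) (w : FreeMonoid X), w.length < n → coeff w (f ^ n) = 0 := by
  intro n
  induction n with
  | zero => intro w h; omega
  | succ n ih =>
    intro w h
    rw [pow_succ, coeff_mul]
    refine Finset.sum_eq_zero ?_
    rintro ⟨a, b⟩ hp
    rw [Finset.HasMulAntidiagonal.mem_mulAntidiagonal] at hp
    by_cases hb : b = 1
    · simp [hb, hf]
    · have h1 : b.length ≠ 0 := fun h0 => hb (FreeMonoid.length_eq_zero.mp h0)
      have h2 : a.length + b.length = w.length := by
        rw [← hp, FreeMonoid.length_mul]
      rw [ih a (by omega), zero_mul]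

theorem familySummable_pow {f : Series k X} (hf : coeff 1 f = 0) :
    FamilySummable fun n : ℕ => f ^ n := by
  intro w
  refine (Set.finite_Iic w.length).subset fun n hn => ?_
  by_contra h
  exact hn (coeff_pow_eq_zero hf n w (by simpa using h))

/-- The infinite linear combination `∑_x α(x) x` of letters. -/
def linear (α : X → k) : Series k X := familySum fun x => α x • letter x

theorem familySummable_linear (α : X → k) :
    FamilySummable fun x => α x • (letter x : Series k X) := by
  intro w
  refine Set.Subsingleton.finite fun x hx y hy => ?_
  have key : ∀ z, z ∈ (Function.support fun x => coeff w (α x • (letter x : Series k X))) →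
      w = FreeMonoid.of z := by
    intro z hz
    by_contra h
    refine hz ?_
    have : coeff w (letter z : Series k X) = 0 := coeff_word_of_ne h
    simp [this]
  exact FreeMonoid.of_injective ((key x hx).symm.trans (key y hy))

/-- A subset of `k⟨⟨X⟩⟩` that is a (unital) subalgebra, that is, a subsemiring stable under
scaling on both sides, and that contains the star of each of its members
without constant term. -/
structure IsStarClosedSubalgebra (S : Subsemiring (Series k X)) : Prop where
  smul_mem : ∀ (c : k), ∀ f ∈ S, c • f ∈ S
  op_smul_mem : ∀ (c : k), ∀ f ∈ S, MulOpposite.op c • f ∈ S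
  kstar_mem : ∀ f ∈ S, coeff 1 f = 0 → kstar f ∈ S

/-- The rational closure of a set of series: the smallest star-closed subalgebra
containing it. -/
def rationalClosure (A : Set (Series k X)) : Subsemiring (Series k X) :=
  sInf {S | IsStarClosedSubalgebra S ∧ A ⊆ S}

theorem subset_rationalClosure (A : Set (Series k X)) : A ⊆ rationalClosure A := fun _ hf =>
  Subsemiring.mem_sInf.mpr fun _ hS => hS.2 hf

theorem isStarClosedSubalgebra_rationalClosure (A : Set (Series k X)) :
    IsStarClosedSubalgebra (rationalClosure A) where
  smul_mem c f hf := Subsemiring.mem_sInf.mpr fun S hS =>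
    hS.1.smul_mem c f (Subsemiring.mem_sInf.mp hf S hS)
  op_smul_mem c f hf := Subsemiring.mem_sInf.mpr fun S hS =>
    hS.1.op_smul_mem c f (Subsemiring.mem_sInf.mp hf S hS)
  kstar_mem f hf h := Subsemiring.mem_sInf.mpr fun S hS =>
    hS.1.kstar_mem f (Subsemiring.mem_sInf.mp hf S hS) h

end Series

end KleeneSchutzenberger

end

noncomputable section

namespace KleeneSchutzenberger

universe u v

/-! ### Linear representations and shift-invariant submodules -/

section Representations

variable {X : Type u} {k : Type v} [Semiring k]

/-! A representation records how shifts act on finitely many generators. The entries of `mu w *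
gam`, as functions of `w`, span a left module stable under right shifts; the entries of `lam * mu w`
span a right module stable under left shifts. Conversely, the shifts of the generators by each
letter give matrices, and since `FreeMonoid X` is free these extend to a morphism with no relation
to check, even if the generators are dependent.

From a representation to rationality: the column `y = mu(·) * gam` solves `y = A y + gam`, where `A
i j = ∑ x, mu(x) i j • x` has no constant term. Arden's lemma and Gaussian elimination
(`solution_mem`) solve it using only sums, products and stars. The entries of `A` are infinite sums
over an infinite alphabet, hence the generators `linear α`.

From rationality to shifts: the shift by a letter is a twisted derivation (`letterShift_mul`), so
the series lying in finitely generated modules stable under letter shifts form a star-closed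
subalgebra, which contains the generators. -/

theorem HasLinearRepresentation.rightShiftsFG {M : Type u} [Monoid M] {f : M → k}
    (hf : HasLinearRepresentation f) : RightShiftsFG f := by
  obtain ⟨n, lam, mu, gam, h⟩ := hf
  let g : Fin n → M → k := fun i w => (mu w * gam) i 0
  have hg : ∀ a i, rightShift a (g i) = ∑ j, mu a i j • g j := by
    intro a i
    ext w
    simp only [rightShift, g, map_mul, Matrix.mul_assoc, Finset.sum_apply, Pi.smul_apply,
      smul_eq_mul]
    rw [Matrix.mul_apply]
  refine ⟨Submodule.span k (Set.range g), Submodule.fg_span (Set.finite_range g), ?_, ?_⟩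
  · intro a φ hφ
    obtain ⟨c, rfl⟩ := (Submodule.mem_span_range_iff_exists_fun k).mp hφ
    have : rightShift a (∑ i, c i • g i) = ∑ i, c i • rightShift a (g i) := by
      ext w
      simp [rightShift]
    rw [this]
    refine Submodule.sum_mem _ fun i _ => Submodule.smul_mem _ _ ?_
    rw [hg]
    exact Submodule.sum_mem _ fun j _ =>
      Submodule.smul_mem _ _ (Submodule.subset_span (Set.mem_range_self j))
  · intro w
    have : rightShift w f = ∑ i, (lam * mu w) 0 i • g i := by
      ext x
      simp only [rightShift, h, map_mul, g, Finset.sum_apply, Pi.smul_apply, smul_eq_mul]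
      rw [← Matrix.mul_assoc, Matrix.mul_assoc (lam * mu w), Matrix.mul_apply]
    rw [this]
    exact Submodule.sum_mem _ fun j _ =>
      Submodule.smul_mem _ _ (Submodule.subset_span (Set.mem_range_self j))

theorem HasLinearRepresentation.leftShiftsFG {M : Type u} [Monoid M] {f : M → k}
    (hf : HasLinearRepresentation f) : LeftShiftsFG f := by
  obtain ⟨n, lam, mu, gam, h⟩ := hf
  let g : Fin n → M → k := fun i w => (lam * mu w) 0 i
  have hg : ∀ a j, leftShift a (g j) = ∑ i, MulOpposite.op (mu a i j) • g i := by
    intro a j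
    ext w
    simp only [leftShift, g, map_mul, ← Matrix.mul_assoc, Finset.sum_apply, Pi.smul_apply,
      MulOpposite.smul_eq_mul_unop, MulOpposite.unop_op]
    rw [Matrix.mul_apply]
  refine ⟨Submodule.span kᵐᵒᵖ (Set.range g), Submodule.fg_span (Set.finite_range g), ?_, ?_⟩
  · intro a φ hφ
    obtain ⟨c, rfl⟩ := (Submodule.mem_span_range_iff_exists_fun kᵐᵒᵖ).mp hφ
    have : leftShift a (∑ i, c i • g i) = ∑ i, c i • leftShift a (g i) := by
      ext w
      simp [leftShift]
    rw [this]
    refine Submodule.sum_mem _ fun i _ => Submodule.smul_mem _ _ ?_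
    rw [hg]
    exact Submodule.sum_mem _ fun j _ =>
      Submodule.smul_mem _ _ (Submodule.subset_span (Set.mem_range_self j))
  · intro w
    have : leftShift w f = ∑ i, MulOpposite.op ((mu w * gam) i 0) • g i := by
      ext x
      simp only [leftShift, h, map_mul, g, Finset.sum_apply, Pi.smul_apply,
        MulOpposite.smul_eq_mul_unop, MulOpposite.unop_op]
      rw [← Matrix.mul_assoc, Matrix.mul_assoc (lam * mu x), Matrix.mul_apply]
    rw [this]
    exact Submodule.sum_mem _ fun j _ =>
      Submodule.smul_mem _ _ (Submodule.subset_span (Set.mem_range_self j))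

/-- The generators need not be independent: any choice of coefficients for each letter will do,
because a morphism on a free monoid is determined by arbitrary values on letters. -/
theorem RightShiftsFG.hasLinearRepresentation {f : FreeMonoid X → k} (hf : RightShiftsFG f) :
    HasLinearRepresentation f := by
  obtain ⟨W, hW, hinv, hmem⟩ := hf
  obtain ⟨n, g, rfl⟩ := Submodule.fg_iff_exists_fin_generating_family.mp hW
  have hlam := hmem 1
  have hmu : ∀ x i, ∃ c : Fin n → k, ∑ j, c j • g j = rightShift (FreeMonoid.of x) (g i) :=
    fun x i => (Submodule.mem_span_range_iff_exists_fun k).mp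
      (hinv _ _ (Submodule.subset_span (Set.mem_range_self i)))
  obtain ⟨lam, hlam⟩ := (Submodule.mem_span_range_iff_exists_fun k).mp hlam
  choose m hm using hmu
  let mu : FreeMonoid X →* Matrix (Fin n) (Fin n) k :=
    FreeMonoid.lift fun x => Matrix.of (m x)
  have key : ∀ w i y, g i (w * y) = ∑ j, mu w i j * g j y := by
    intro w
    induction w using FreeMonoid.recOn with
    | one => intro i y; simp [Matrix.one_apply]
    | of_mul x w ih =>
      intro i y
      have h1 : g i (FreeMonoid.of x * (w * y)) = ∑ j, m x i j * g j (w * y) := by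
        simpa [rightShift] using (congrFun (hm x i) (w * y)).symm
      rw [mul_assoc, h1, map_mul]
      simp only [Matrix.mul_apply, ih, Finset.mul_sum, Finset.sum_mul, ← mul_assoc]
      rw [Finset.sum_comm]
      simp [mu]
  refine ⟨n, Matrix.of fun _ i => lam i, mu, Matrix.of fun i _ => g i 1, fun w => ?_⟩
  have h1 : f w = ∑ i, lam i * g i w := by
    simpa [rightShift] using (congrFun hlam w).symm
  have h2 : ∀ i, g i w = ∑ j, mu w i j * g j 1 := fun i => by simpa using key w i 1
  rw [h1, Matrix.mul_assoc, Matrix.mul_apply]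
  simp only [Matrix.mul_apply, Matrix.of_apply, h2]

theorem LeftShiftsFG.hasLinearRepresentation {f : FreeMonoid X → k} (hf : LeftShiftsFG f) :
    HasLinearRepresentation f := by
  obtain ⟨W, hW, hinv, hmem⟩ := hf
  obtain ⟨n, g, rfl⟩ := Submodule.fg_iff_exists_fin_generating_family.mp hW
  have hgam := hmem 1
  have hmu : ∀ x j, ∃ c : Fin n → kᵐᵒᵖ, ∑ i, c i • g i = leftShift (FreeMonoid.of x) (g j) :=
    fun x j => (Submodule.mem_span_range_iff_exists_fun kᵐᵒᵖ).mp
      (hinv _ _ (Submodule.subset_span (Set.mem_range_self j)))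
  obtain ⟨gam, hgam⟩ := (Submodule.mem_span_range_iff_exists_fun kᵐᵒᵖ).mp hgam
  choose m hm using hmu
  let mu : FreeMonoid X →* Matrix (Fin n) (Fin n) k :=
    FreeMonoid.lift fun x => Matrix.of fun i j => (m x j i).unop
  -- The prefix `y` has to vary: letters are removed from the left of `w`, and the induction
  -- hypothesis is applied with `y` lengthened by that letter.
  have key : ∀ w j y, g j (y * w) = ∑ i, g i y * mu w i j := by
    intro w
    induction w using FreeMonoid.recOn with
    | one => intro i y; simp [Matrix.one_apply]
    | of_mul x w ih =>
      intro j y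
      have h1 : ∀ i, g i (y * FreeMonoid.of x) = ∑ l, g l y * (m x i l).unop := fun i => by
        simpa [leftShift, MulOpposite.smul_eq_mul_unop] using (congrFun (hm x i) y).symm
      rw [← mul_assoc, ih, map_mul]
      simp only [Matrix.mul_apply, h1, Finset.mul_sum, Finset.sum_mul, ← mul_assoc]
      rw [Finset.sum_comm]
      simp [mu]
  refine ⟨n, Matrix.of fun _ i => g i 1, mu, Matrix.of fun i _ => (gam i).unop, fun w => ?_⟩
  have h1 : f w = ∑ i, g i w * (gam i).unop := by
    simpa [leftShift, MulOpposite.smul_eq_mul_unop] using (congrFun hgam w).symm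
  have h2 : ∀ j, g j w = ∑ i, g i 1 * mu w i j := fun j => by simpa using key w j 1
  rw [h1, Matrix.mul_apply]
  simp only [Matrix.mul_apply, Matrix.of_apply, h2]

end Representations

namespace Series

variable {k : Type v} {X : Type u} [Semiring k]

/-! ### Words, letters and shifts by a letter -/

theorem of_mul_ne_one (x : X) (w : FreeMonoid X) : FreeMonoid.of x * w ≠ 1 := by
  intro h
  simpa using congrArg FreeMonoid.length h

theorem sum_mulAntidiagonal_one {A : Type*} [AddCommMonoid A]
    (F : FreeMonoid X × FreeMonoid X → A) :
    ∑ p ∈ Finset.HasMulAntidiagonal.mulAntidiagonal (1 : FreeMonoid X), F p = F (1, 1) := by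
  refine Finset.sum_eq_single_of_mem _ (by simp) ?_
  rintro ⟨a, b⟩ hp hne
  rw [Finset.HasMulAntidiagonal.mem_mulAntidiagonal] at hp
  have hl := congrArg FreeMonoid.length hp
  simp only [FreeMonoid.length_mul, FreeMonoid.length_one, Nat.add_eq_zero_iff,
    FreeMonoid.length_eq_zero] at hl
  exact absurd (Prod.ext hl.1 hl.2) hne

/-- In a factorization of a word starting with `x`, the left factor is either empty or itself starts
with `x`. -/
theorem sum_mulAntidiagonal_of_mul {A : Type*} [AddCommMonoid A]
    (F : FreeMonoid X × FreeMonoid X → A) (x : X) (w : FreeMonoid X) :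
    ∑ p ∈ Finset.HasMulAntidiagonal.mulAntidiagonal (FreeMonoid.of x * w), F p =
      F (1, FreeMonoid.of x * w) +
        ∑ p ∈ Finset.HasMulAntidiagonal.mulAntidiagonal w, F (FreeMonoid.of x * p.1, p.2) := by
  classical
  have hset : Finset.HasMulAntidiagonal.mulAntidiagonal (FreeMonoid.of x * w) =
      insert (1, FreeMonoid.of x * w) ((Finset.HasMulAntidiagonal.mulAntidiagonal w).image
        fun p => (FreeMonoid.of x * p.1, p.2)) := by
    ext ⟨a, b⟩
    simp only [Finset.HasMulAntidiagonal.mem_mulAntidiagonal, Finset.mem_insert,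
      Finset.mem_image, Prod.mk.injEq, Prod.exists]
    constructor
    · intro h
      cases a using FreeMonoid.casesOn with
      | one => exact Or.inl ⟨rfl, by simpa using h⟩
      | of_mul y a =>
        right
        have h' : y :: (a * b).toList = x :: w.toList := by
          simpa [FreeMonoid.toList_mul] using congrArg FreeMonoid.toList h
        obtain ⟨rfl, h2⟩ := List.cons.inj h'
        exact ⟨a, b, FreeMonoid.toList.injective h2, rfl, rfl⟩
    · rintro (⟨rfl, rfl⟩ | ⟨c, d, rfl, rfl, rfl⟩)
      · simp
      · simp [mul_assoc]
  rw [hset, Finset.sum_insert, Finset.sum_image]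
  · rintro ⟨a, b⟩ - ⟨c, d⟩ - h
    simp only [Prod.mk.injEq] at h
    exact Prod.ext (mul_left_cancel h.1) h.2
  · simp only [Finset.mem_image, Prod.mk.injEq, Prod.exists, not_exists, not_and]
    intro a b _ h
    exact absurd h (of_mul_ne_one x a)

theorem coeff_one_mul_eq (f g : Series k X) : coeff 1 (f * g) = coeff 1 f * coeff 1 g := by
  rw [coeff_mul, sum_mulAntidiagonal_one]

theorem smul_mul (c : k) (f g : Series k X) : (c • f) * g = c • (f * g) := by
  ext w
  simp [coeff_mul, Finset.mul_sum, mul_assoc]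

/-- The right shift of series by a letter, as a left linear map. -/
def letterShift (x : X) : Series k X →ₗ[k] Series k X where
  toFun f := ofFun (rightShift (FreeMonoid.of x) f)
  map_add' _ _ := rfl
  map_smul' _ _ := rfl

@[simp] theorem coeff_letterShift (x : X) (w : FreeMonoid X) (f : Series k X) :
    coeff w (letterShift x f) = coeff (FreeMonoid.of x * w) f := rfl

/-- The twisted Leibniz rule behind all closure properties of recognizable series; the second term
comes from the factorization with empty left factor. -/
theorem letterShift_mul (x : X) (f g : Series k X) :
    letterShift x (f * g) = letterShift x f * g + coeff 1 f • letterShift x g := by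
  ext w
  simp only [coeff_letterShift, coeff_add, coeff_smul, coeff_mul, sum_mulAntidiagonal_of_mul]
  exact add_comm _ _

@[simp] theorem letterShift_one (x : X) : letterShift x (1 : Series k X) = 0 := by
  ext w
  exact coeff_one_of_ne (of_mul_ne_one x w)

theorem coeff_linear_one (α : X → k) : coeff 1 (linear α) = 0 := by
  refine (finsum_congr fun x => ?_).trans finsum_zero
  have : coeff 1 (letter x : Series k X) = 0 :=
    coeff_word_of_ne (by simp)
  simp [this]

theorem letterShift_letter_self (x : X) : letterShift x (letter x : Series k X) = 1 := by
  ext w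
  by_cases hw : w = 1
  · subst hw
    rw [coeff_one_self, coeff_letterShift, mul_one]
    exact coeff_word_self _
  · rw [coeff_one_of_ne hw, coeff_letterShift]
    exact coeff_word_of_ne fun h => hw (mul_left_cancel (h.trans (mul_one _).symm))

theorem letterShift_letter_of_ne {x y : X} (h : x ≠ y) :
    letterShift x (letter y : Series k X) = 0 := by
  ext w
  refine coeff_word_of_ne fun hw => h ?_
  have := congrArg FreeMonoid.toList hw
  simp only [FreeMonoid.toList_mul, FreeMonoid.toList_of] at this
  exact (List.cons.inj this).1

theorem letterShift_linear (x : X) (α : X → k) :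
    letterShift x (linear α) = α x • (1 : Series k X) := by
  ext w
  have h : coeff w (letterShift x (linear α)) =
      ∑ᶠ y, α y * coeff w (letterShift x (letter y : Series k X)) := rfl
  rw [h, finsum_eq_single _ x, letterShift_letter_self, coeff_smul]
  intro y hy
  simp [letterShift_letter_of_ne hy.symm]

/-- Two series agree if they have the same constant term and the same shifts by letters. -/
theorem ext_letterShift {f g : Series k X} (h1 : coeff 1 f = coeff 1 g)
    (h : ∀ x, letterShift x f = letterShift x g) : f = g := by
  ext w
  cases w using FreeMonoid.casesOn with
  | one => exact h1
  | of_mul x w => exact congrArg (coeff w) (h x)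

theorem letter_eq_linear [DecidableEq X] (x : X) :
    (letter x : Series k X) = linear (Pi.single x 1) := by
  refine ext_letterShift ?_ fun y => ?_
  · rw [coeff_linear_one]
    exact coeff_word_of_ne (by simp)
  · rw [letterShift_linear]
    by_cases h : y = x
    · subst h
      simp [letterShift_letter_self]
    · simp [letterShift_letter_of_ne h, h]

theorem linear_eq_sum [Fintype X] (α : X → k) :
    linear α = ∑ x, α x • (letter x : Series k X) := by
  classical
  refine ext_letterShift ?_ fun y => ?_
  · have h : coeff 1 (∑ x, α x • (letter x : Series k X)) =
        ∑ x, coeff 1 (α x • (letter x : Series k X)) := Finset.sum_apply _ _ _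
    rw [coeff_linear_one, h]
    refine (Finset.sum_eq_zero fun x _ => ?_).symm
    rw [letter_eq_linear, coeff_smul, coeff_linear_one, mul_zero]
  · rw [letterShift_linear, map_sum, Finset.sum_eq_single y]
    · rw [map_smul, letterShift_letter_self]
    · intro x _ hx
      rw [map_smul, letterShift_letter_of_ne hx.symm, smul_zero]
    · simp

/-! ### The star -/

/-- The bound `N` is left free so that all suffixes of one word can share the same truncation. -/
theorem coeff_kstar {f : Series k X} (hf : coeff 1 f = 0) {w : FreeMonoid X} {N : ℕ}
    (hN : w.length < N) : coeff w (kstar f) = ∑ n ∈ Finset.range N, coeff w (f ^ n) := by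
  refine finsum_eq_sum_of_support_subset _ fun n hn => ?_
  by_contra h
  exact hn (coeff_pow_eq_zero hf n w (by simp at h; omega))

theorem kstar_eq {f : Series k X} (hf : coeff 1 f = 0) : kstar f = 1 + f * kstar f := by
  ext w
  have h : coeff w (f * kstar f) = ∑ n ∈ Finset.range (w.length + 1), coeff w (f ^ (n + 1)) := by
    simp only [pow_succ', coeff_mul]
    rw [Finset.sum_comm]
    refine Finset.sum_congr rfl ?_
    rintro ⟨a, b⟩ hp
    rw [Finset.HasMulAntidiagonal.mem_mulAntidiagonal] at hp
    have hl : a.length + b.length = w.length := by rw [← hp, FreeMonoid.length_mul]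
    rw [coeff_kstar hf (N := w.length + 1) (by simp only; omega), Finset.mul_sum]
  -- Removing the term `n = 0` from `w.length + 2` terms leaves exactly the `w.length + 1` terms of
  -- `h`.
  rw [coeff_add, h, coeff_kstar hf (N := w.length + 2) (by omega), Finset.sum_range_succ', pow_zero,
    add_comm]

/-- Uniqueness in Arden's lemma. -/
theorem eq_of_eq_mul_add {a b y z : Series k X} (ha : coeff 1 a = 0) (hy : y = a * y + b)
    (hz : z = a * z + b) : y = z := by
  -- Since `a` has no constant term, only strictly shorter suffixes of `w` contribute to the
  -- products.
  have key : ∀ n, ∀ w : FreeMonoid X, w.length < n → coeff w y = coeff w z := by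
    intro n
    induction n with
    | zero => intro w h; omega
    | succ n ih =>
      intro w hw
      rw [hy, hz, coeff_add, coeff_add, coeff_mul, coeff_mul]
      congr 1
      refine Finset.sum_congr rfl ?_
      rintro ⟨c, d⟩ hp
      rw [Finset.HasMulAntidiagonal.mem_mulAntidiagonal] at hp
      by_cases hc : c = 1
      · simp [hc, ha]
      · have h1 : c.length ≠ 0 := fun h0 => hc (FreeMonoid.length_eq_zero.mp h0)
        have h2 : c.length + d.length = w.length := by rw [← hp, FreeMonoid.length_mul]
        rw [ih d (by omega)]
  ext w
  exact key _ w (Nat.lt_succ_self _)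

/-- Arden's lemma. -/
theorem eq_kstar_mul_of_eq_mul_add {a b y : Series k X} (ha : coeff 1 a = 0)
    (hy : y = a * y + b) : y = kstar a * b := by
  refine eq_of_eq_mul_add ha hy ?_
  conv_lhs => rw [kstar_eq ha]
  rw [add_mul, one_mul, mul_assoc, add_comm]

/-- The solution of a proper linear system with coefficients in a star-closed subalgebra
lies in that subalgebra. -/
theorem IsStarClosedSubalgebra.solution_mem {S : Subsemiring (Series k X)}
    (hS : IsStarClosedSubalgebra S) :
    ∀ (n : ℕ) (A : Fin n → Fin n → Series k X) (c y : Fin n → Series k X),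
      (∀ i j, A i j ∈ S) → (∀ i j, coeff 1 (A i j) = 0) → (∀ i, c i ∈ S) →
      (∀ i, y i = ∑ j, A i j * y j + c i) → ∀ i, y i ∈ S := by
  intro n
  induction n with
  | zero => intro A c y _ _ _ _ i; exact i.elim0
  | succ n ih =>
    intro A c y hA hA1 hc hy
    have hstar : kstar (A 0 0) ∈ S := hS.kstar_mem _ (hA 0 0) (hA1 0 0)
    have h0 : y 0 = kstar (A 0 0) * (∑ j : Fin n, A 0 j.succ * y j.succ + c 0) := by
      refine eq_kstar_mul_of_eq_mul_add (hA1 0 0) ?_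
      conv_lhs => rw [hy 0, Fin.sum_univ_succ, add_assoc]
    -- Gaussian elimination: substituting `h0` for `y 0` leaves a system in `n` unknowns, whose
    -- coefficients still have zero constant term.
    have hsucc : ∀ i : Fin n, y i.succ ∈ S := by
      refine ih (fun i j => A i.succ 0 * kstar (A 0 0) * A 0 j.succ + A i.succ j.succ)
        (fun i => A i.succ 0 * kstar (A 0 0) * c 0 + c i.succ) (fun i => y i.succ) ?_ ?_ ?_ ?_
      · intro i j
        exact S.add_mem (S.mul_mem (S.mul_mem (hA _ _) hstar) (hA _ _)) (hA _ _)
      · intro i j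
        rw [coeff_add, coeff_one_mul_eq, hA1, hA1, mul_zero, add_zero]
      · intro i
        exact S.add_mem (S.mul_mem (S.mul_mem (hA _ _) hstar) (hc _)) (hc _)
      · intro i
        rw [hy i.succ, Fin.sum_univ_succ, h0]
        simp only [mul_add, add_mul, Finset.mul_sum, Finset.sum_add_distrib, mul_assoc]
        abel
    intro i
    refine Fin.cases ?_ hsucc i
    rw [h0]
    exact S.mul_mem hstar (S.add_mem (S.sum_mem fun j _ => S.mul_mem (hA _ _) (hsucc j)) (hc 0))

theorem IsStarClosedSubalgebra.mem_of_hasLinearRepresentation {S : Subsemiring (Series k X)}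
    (hS : IsStarClosedSubalgebra S) (hlin : ∀ α : X → k, linear α ∈ S) {f : FreeMonoid X → k}
    (hf : HasLinearRepresentation f) : ofFun f ∈ S := by
  obtain ⟨n, lam, mu, gam, h⟩ := hf
  let y : Fin n → Series k X := fun i => ofFun fun w => (mu w * gam) i 0
  have coeff_sum : ∀ (w : FreeMonoid X) (F : Fin n → Series k X),
      coeff w (∑ i, F i) = ∑ i, coeff w (F i) := fun w F => Finset.sum_apply w _ F
  have hy : ∀ i, y i ∈ S := by
    -- The constant term of the system is `mu 1 = 1`; its shift by `x` is `mu (x * w) = mu x * mu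
    -- w`.
    refine hS.solution_mem n (fun i j => linear fun x => mu (FreeMonoid.of x) i j)
      (fun i => gam i 0 • 1) y (fun _ _ => hlin _) (fun _ _ => coeff_linear_one _)
      (fun _ => hS.smul_mem _ _ S.one_mem) fun i => ext_letterShift ?_ fun x => ?_
    · simp [y, coeff_sum, coeff_one_mul_eq, coeff_linear_one, coeff_one_self]
    · ext w
      simp only [map_add, map_sum, letterShift_mul, letterShift_linear, coeff_linear_one,
        zero_smul, add_zero, map_smul, letterShift_one, smul_zero, coeff_sum, y,
        coeff_letterShift, coeff_ofFun, map_mul, Matrix.mul_assoc]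
      rw [Matrix.mul_apply]
      refine Finset.sum_congr rfl fun j _ => ?_
      rw [smul_mul, one_mul, coeff_smul, coeff_ofFun]
  have hsum : ofFun f = ∑ i, lam 0 i • y i := by
    ext w
    rw [coeff_sum, coeff_ofFun, h, Matrix.mul_assoc, Matrix.mul_apply]
    rfl
  rw [hsum]
  exact S.sum_mem fun i _ => hS.smul_mem _ _ (hy i)

/-! ### Recognizable series form a star-closed subalgebra -/

/-- The series lies in a finitely generated left submodule invariant under the right shifts
by letters. -/
def IsRecognizable (f : Series k X) : Prop :=
  ∃ W : Submodule k (Series k X), W.FG ∧ (∀ x, ∀ g ∈ W, letterShift x g ∈ W) ∧ f ∈ W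

theorem IsRecognizable.rightShiftsFG {f : FreeMonoid X → k} (hf : IsRecognizable (ofFun f)) :
    RightShiftsFG f := by
  obtain ⟨W, hW, hinv, hmem⟩ := hf
  have key : ∀ a : FreeMonoid X, ∀ g ∈ W, ofFun (rightShift a g) ∈ W := by
    intro a
    induction a using FreeMonoid.recOn with
    | one =>
      intro g hg
      have : ofFun (rightShift 1 g) = g := by
        ext w
        exact congrArg (fun v => coeff v g) (one_mul w)
      rwa [this]
    | of_mul x a ih =>
      intro g hg
      have : ofFun (rightShift (FreeMonoid.of x * a) g) =
          ofFun (rightShift a (letterShift x g)) := by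
        ext w
        exact congrArg (fun v => coeff v g) (mul_assoc (FreeMonoid.of x) a w)
      rw [this]
      exact ih _ (hinv x g hg)
  exact ⟨W, hW, key, fun w => key w _ hmem⟩

/-- Right multiplication by a series, as a left linear map. -/
def mulRight (g : Series k X) : Series k X →ₗ[k] Series k X where
  toFun f := f * g
  map_add' _ _ := add_mul _ _ _
  map_smul' c f := smul_mul c f g

@[simp] theorem mulRight_apply (f g : Series k X) : mulRight g f = f * g := rfl

theorem isRecognizable_one : IsRecognizable (1 : Series k X) := by
  refine ⟨Submodule.span k {1}, Submodule.fg_span (Set.finite_singleton _), ?_,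
    Submodule.mem_span_singleton_self _⟩
  intro x g hg
  obtain ⟨c, rfl⟩ := Submodule.mem_span_singleton.mp hg
  simp

theorem isRecognizable_zero : IsRecognizable (0 : Series k X) :=
  ⟨⊥, Submodule.fg_bot, by simp, Submodule.zero_mem _⟩

theorem isRecognizable_linear (α : X → k) : IsRecognizable (linear α) := by
  refine ⟨Submodule.span k {linear α, 1}, Submodule.fg_span (Set.toFinite _), ?_,
    Submodule.subset_span (by simp)⟩
  intro x g hg
  obtain ⟨c, d, rfl⟩ := Submodule.mem_span_pair.mp hg
  rw [map_add, map_smul, map_smul, letterShift_one, letterShift_linear, smul_zero, add_zero]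
  exact Submodule.smul_mem _ _ (Submodule.smul_mem _ _ (Submodule.subset_span (by simp)))

theorem IsRecognizable.add {f g : Series k X} (hf : IsRecognizable f) (hg : IsRecognizable g) :
    IsRecognizable (f + g) := by
  obtain ⟨V, hV, hVi, hfV⟩ := hf
  obtain ⟨W, hW, hWi, hgW⟩ := hg
  refine ⟨V ⊔ W, hV.sup hW, ?_, Submodule.add_mem_sup hfV hgW⟩
  intro x h hh
  obtain ⟨a, ha, b, hb, rfl⟩ := Submodule.mem_sup.mp hh
  rw [map_add]
  exact Submodule.add_mem_sup (hVi x a ha) (hWi x b hb)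

theorem IsRecognizable.mul {f g : Series k X} (hf : IsRecognizable f) (hg : IsRecognizable g) :
    IsRecognizable (f * g) := by
  obtain ⟨V, hV, hVi, hfV⟩ := hf
  obtain ⟨W, hW, hWi, hgW⟩ := hg
  -- By the Leibniz rule, shifting `v * g` with `v ∈ V` gives an element of `V * g` plus a multiple
  -- of a shift of `g`, which lies in `W`.
  refine ⟨V.map (mulRight g) ⊔ W, (hV.map _).sup hW, ?_,
    Submodule.mem_sup_left (Submodule.mem_map_of_mem (f := mulRight g) hfV)⟩
  intro x h hh
  obtain ⟨a, ha, b, hb, rfl⟩ := Submodule.mem_sup.mp hh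
  obtain ⟨v, hv, rfl⟩ := Submodule.mem_map.mp ha
  rw [map_add, mulRight_apply, letterShift_mul, add_assoc]
  exact Submodule.add_mem_sup (Submodule.mem_map_of_mem (f := mulRight g) (hVi x v hv))
    (W.add_mem (W.smul_mem _ (hWi x g hgW)) (hWi x b hb))

theorem IsRecognizable.smul {f : Series k X} (c : k) (hf : IsRecognizable f) :
    IsRecognizable (c • f) := by
  obtain ⟨W, hW, hWi, hfW⟩ := hf
  exact ⟨W, hW, hWi, W.smul_mem c hfW⟩

theorem IsRecognizable.op_smul {f : Series k X} (c : k) (hf : IsRecognizable f) :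
    IsRecognizable (MulOpposite.op c • f) := by
  -- Right scaling is right multiplication by a constant series, so closure under products applies.
  have : MulOpposite.op c • f = f * (c • 1) := by
    ext w
    conv_lhs => rw [← mul_one f]
    rw [coeff_op_smul, coeff_mul, coeff_mul, Finset.sum_mul]
    refine Finset.sum_congr rfl fun p _ => ?_
    by_cases hp : p.2 = 1
    · simp [hp, coeff_one_self]
    · simp [coeff_one_of_ne hp]
  rw [this]
  exact hf.mul (isRecognizable_one.smul c)

/-- Shifting `f^* = 1 + f f^*` by a letter kills `1` and gives the shift of `f` times `f^*`, so `W
f^* + k f^*` is stable. The second summand is there to contain `f^*`, as `W` need not contain `1`.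
-/
theorem IsRecognizable.kstar {f : Series k X} (hf : IsRecognizable f) (h1 : coeff 1 f = 0) :
    IsRecognizable (kstar f) := by
  obtain ⟨W, hW, hWi, hfW⟩ := hf
  have hshift : ∀ x, letterShift x (Series.kstar f) = letterShift x f * Series.kstar f := by
    intro x
    conv_lhs => rw [kstar_eq h1]
    rw [map_add, letterShift_one, zero_add, letterShift_mul, h1, zero_smul, add_zero]
  have hmem : ∀ g ∈ W, g * Series.kstar f ∈ W.map (mulRight (Series.kstar f)) := fun g hg =>
    Submodule.mem_map_of_mem (f := mulRight (Series.kstar f)) hg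
  refine ⟨W.map (mulRight (Series.kstar f)) ⊔ Submodule.span k {Series.kstar f},
    (hW.map _).sup (Submodule.fg_span (Set.finite_singleton _)), ?_,
    Submodule.mem_sup_right (Submodule.mem_span_singleton_self _)⟩
  intro x h hh
  obtain ⟨a, ha, b, hb, rfl⟩ := Submodule.mem_sup.mp hh
  obtain ⟨v, hv, rfl⟩ := Submodule.mem_map.mp ha
  obtain ⟨c, rfl⟩ := Submodule.mem_span_singleton.mp hb
  rw [map_add, mulRight_apply, letterShift_mul, map_smul, hshift]
  have hx := hmem _ (hWi x f hfW)
  exact Submodule.mem_sup_left (Submodule.add_mem _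
    (Submodule.add_mem _ (hmem _ (hWi x v hv)) (Submodule.smul_mem _ _ hx))
    (Submodule.smul_mem _ _ hx))

/-- The subsemiring of recognizable series. -/
def recognizable (k : Type v) (X : Type u) [Semiring k] : Subsemiring (Series k X) where
  carrier := {f | IsRecognizable f}
  mul_mem' := IsRecognizable.mul
  one_mem' := isRecognizable_one
  add_mem' := IsRecognizable.add
  zero_mem' := isRecognizable_zero

theorem isStarClosedSubalgebra_recognizable :
    IsStarClosedSubalgebra (recognizable k X) where
  smul_mem c _ hf := IsRecognizable.smul c hf
  op_smul_mem c _ hf := IsRecognizable.op_smul c hf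
  kstar_mem _ hf h := IsRecognizable.kstar hf h

/-! ### The equivalences -/

theorem rightShiftsFG_of_mem_rationalClosure {A : Set (Series k X)}
    (hA : ∀ g ∈ A, IsRecognizable g) {f : FreeMonoid X → k}
    (hf : ofFun f ∈ rationalClosure A) : RightShiftsFG f :=
  IsRecognizable.rightShiftsFG
    (Subsemiring.mem_sInf.mp hf (recognizable k X) ⟨isStarClosedSubalgebra_recognizable, hA⟩)

/-- The Kleene–Schützenberger equivalences, for any set of recognizable generators whose
rational closure contains the linear series. -/
theorem tfae_of_generators {A : Set (Series k X)} (hA : ∀ g ∈ A, IsRecognizable g)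
    (hlin : ∀ α : X → k, linear α ∈ rationalClosure A) (f : FreeMonoid X → k) :
    List.TFAE [RightShiftsFG f, LeftShiftsFG f, HasLinearRepresentation f,
      ofFun f ∈ rationalClosure A] := by
  tfae_have 1 → 3 := RightShiftsFG.hasLinearRepresentation
  tfae_have 2 → 3 := LeftShiftsFG.hasLinearRepresentation
  tfae_have 3 → 2 := HasLinearRepresentation.leftShiftsFG
  tfae_have 3 → 4 :=
    (isStarClosedSubalgebra_rationalClosure A).mem_of_hasLinearRepresentation hlin
  tfae_have 4 → 1 := rightShiftsFG_of_mem_rationalClosure hA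
  tfae_finish

end Series

end KleeneSchutzenberger

end

/-- Kleene–Schützenberger over an arbitrary alphabet. For a finite alphabet the generating set
of the rational closure may be taken to be the set of letters. -/
theorem mainTheorem2 {X : Type*} {k : Type*} [Semiring k] (f : FreeMonoid X → k) :
    List.TFAE
      [KleeneSchutzenberger.RightShiftsFG f,
       KleeneSchutzenberger.LeftShiftsFG f,
       KleeneSchutzenberger.HasLinearRepresentation f,
       KleeneSchutzenberger.Series.ofFun f ∈
         KleeneSchutzenberger.Series.rationalClosure
           (Set.range fun α : X → k => KleeneSchutzenberger.Series.linear α)] ∧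
    (Finite X → List.TFAE
      [KleeneSchutzenberger.RightShiftsFG f,
       KleeneSchutzenberger.LeftShiftsFG f,
       KleeneSchutzenberger.HasLinearRepresentation f,
       KleeneSchutzenberger.Series.ofFun f ∈
         KleeneSchutzenberger.Series.rationalClosure
           (Set.range fun x : X => (KleeneSchutzenberger.Series.letter x :
             KleeneSchutzenberger.Series k X))]) := by
  classical
  refine ⟨KleeneSchutzenberger.Series.tfae_of_generators ?_ ?_ f, fun hX =>
    KleeneSchutzenberger.Series.tfae_of_generators ?_ ?_ f⟩
  · rintro _ ⟨α, rfl⟩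
    exact KleeneSchutzenberger.Series.isRecognizable_linear α
  · exact fun α => KleeneSchutzenberger.Series.subset_rationalClosure _ ⟨α, rfl⟩
  · rintro _ ⟨x, rfl⟩
    simp only [KleeneSchutzenberger.Series.letter_eq_linear]
    exact KleeneSchutzenberger.Series.isRecognizable_linear _
  · intro α
    have := Fintype.ofFinite X
    -- Finiteness of the alphabet enters here: a linear series is then a finite combination of
    -- letters.
    rw [KleeneSchutzenberger.Series.linear_eq_sum]
    exact Subsemiring.sum_mem _ fun x _ =>
      (KleeneSchutzenberger.Series.isStarClosedSubalgebra_rationalClosure _).smul_mem _ _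
        (KleeneSchutzenberger.Series.subset_rationalClosure _ ⟨x, rfl⟩)
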